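/- Let $\mathbb K=\mathbb R$ or $\mathbb K=\mathbb C$ and let $\mu$ be an arbitrary positive (i.e. $[0,+\infty]$-valued, countably additive) measure on a $\sigma$-algebra, not assumed finite or $\sigma$-finite. A continuous linear map $U:E\to F$ of Hausdorff locally convex spaces over $\mathbb K$ is called weakly compact if it maps every bounded subset of $E$ to a relatively weakly compact subset of $F$ (that is, relatively compact for $\sigma(F,F')$). A Hausdorff locally convex space $E$ over $\mathbb K$ is called a Dunford–Pettis space if for every Banach space $F$ over $\mathbb K$, every weakly compact continuous linear map $U:E\to F$ maps every absolutely convex weakly compact subset of $E$ to a relatively norm compact subset of $F$. Then $L^1(\mu,\mathbb K)$ is a Dunford–Pettis space. Moreover, for every Banach space $F$ over $\mathbb K$, every weakly compact continuous linear map $U:L^1(\mu,\mathbb K)\to F$ maps every weakly compact subset of $L^1(\mu,\mathbb K)$ (convex or not) to a norm compact subset of $F$. -/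

import Mathlib

open MeasureTheory

universe uE uF u𝕜

section

variable (𝕜 : Type u𝕜) [RCLike 𝕜]

/-- The set `A` is compact for the weak topology `σ(E, E')`. -/
def IsWeaklyCompact {E : Type uE} [AddCommGroup E] [Module 𝕜 E] [TopologicalSpace E]
    (A : Set E) : Prop :=
  IsCompact (toWeakSpace 𝕜 E '' A)

/-- The set `A` is relatively compact for the weak topology `σ(E, E')`: its closure in the weak
topology is weakly compact. -/
def IsRelativelyWeaklyCompact {E : Type uE} [AddCommGroup E] [Module 𝕜 E] [TopologicalSpace E]
    (A : Set E) : Prop :=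
  IsCompact (closure (toWeakSpace 𝕜 E '' A))

variable {𝕜}

/-- A continuous linear map is weakly compact if it maps (von Neumann) bounded sets to
relatively weakly compact sets. -/
def IsWeaklyCompactOperator {E : Type uE} [AddCommGroup E] [Module 𝕜 E] [TopologicalSpace E]
    {F : Type uF} [AddCommGroup F] [Module 𝕜 F] [TopologicalSpace F] (U : E →L[𝕜] F) : Prop :=
  ∀ B : Set E, Bornology.IsVonNBounded 𝕜 B → IsRelativelyWeaklyCompact 𝕜 (U '' B)

variable (𝕜)

/-- A Hausdorff locally convex space `E` over `𝕜` is a Dunford–Pettis space if every weakly compact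
continuous linear map from `E` to a Banach space maps absolutely convex (that is, balanced and
convex) weakly compact sets to relatively norm compact sets. -/
def IsDunfordPettisSpace (E : Type uE) [AddCommGroup E] [Module 𝕜 E] [Module ℝ E]
    [IsScalarTower ℝ 𝕜 E] [TopologicalSpace E] [IsTopologicalAddGroup E] [ContinuousSMul 𝕜 E]
    [T2Space E] [LocallyConvexSpace ℝ E] : Prop :=
  ∀ (F : Type uF) [NormedAddCommGroup F] [NormedSpace 𝕜 F] [CompleteSpace F] (U : E →L[𝕜] F),
    IsWeaklyCompactOperator U →
      ∀ A : Set E, Balanced 𝕜 A → Convex ℝ A → IsWeaklyCompact 𝕜 A → IsCompact (closure (U '' A))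

end

/-! Two facts are combined. A weakly compact subset of L¹ is equi-integrable
(`IsWeaklyCompact.exists_integrable_setIntegral_norm_le`): up to a small L¹ error it lies in an
order interval {|f| ≤ G} with G integrable. A weakly compact operator maps order intervals to
totally bounded sets (`totallyBounded_image_of_ae_norm_le`). Hence the image of a weakly compact set
is totally bounded; being weakly compact, it is also norm closed, so it is compact.

Equi-integrability rests on a Schur-type theorem, proved by Baire category on {0,1}^ℕ
(`tendsto_eval_of_continuous_subsums`).

For order intervals, it suffices to treat a sequence with |f n| ≤ g. The map x ↦ (f n x / g x)
carries g μ to a finite measure on 𝕜^ℕ and turns the f n into coordinate functions; this disposes of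
any finiteness condition on μ and makes L¹ separable. There, with y k a norming sequence, y k ∘ V
has a density h k, and an averaging argument gives (h k x) = (y k c) for some c in the weakly
compact set C. Partitioning the space according to the approximate value of c approximates V by
finite-rank maps, uniformly on the unit ball of L^∞. -/

open Filter Topology

/-! ### Weakly compact sets in normed spaces. -/

section WeakTopology

variable {𝕜 : Type*} [RCLike 𝕜] {E F : Type*} [NormedAddCommGroup E] [NormedSpace 𝕜 E]
  [NormedAddCommGroup F] [NormedSpace 𝕜 F]

theorem StrongDual.continuous_weakSpace (y : StrongDual 𝕜 E) :
    Continuous fun x : WeakSpace 𝕜 E => y ((toWeakSpace 𝕜 E).symm x) :=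
  WeakBilin.eval_continuous (topDualPairing 𝕜 E).flip y

/-- Replaces the weak topology by a product topology, metrizable when `ι` is countable. -/
theorem IsWeaklyCompact.isCompact_image_of_forall_dual {A : Set E} (hA : IsWeaklyCompact 𝕜 A)
    {ι : Type*} (y : ι → StrongDual 𝕜 E) : IsCompact ((fun x i => y i x) '' A) := by
  have h := hA.image (f := fun x i => y i ((toWeakSpace 𝕜 E).symm x))
    (continuous_pi fun i => (y i).continuous_weakSpace)
  simpa [Set.image_image] using h

/-- Uniform boundedness principle, applied to `A` embedded in the bidual. -/
theorem IsWeaklyCompact.exists_norm_le {A : Set E} (hA : IsWeaklyCompact 𝕜 A) :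
    ∃ R : ℝ, 0 < R ∧ ∀ x ∈ A, ‖x‖ ≤ R := by
  obtain ⟨C, hC⟩ := banach_steinhaus
    (g := fun x : A => NormedSpace.inclusionInDoubleDual 𝕜 E x) (fun y => by
      obtain ⟨C, hC⟩ := (hA.image (f := fun x => y ((toWeakSpace 𝕜 E).symm x))
        y.continuous_weakSpace).isBounded.exists_norm_le
      refine ⟨C, fun x => hC _ ⟨toWeakSpace 𝕜 E x, ⟨x, x.2, rfl⟩, ?_⟩⟩
      simp)
  refine ⟨max C 1, by positivity, fun x hx => le_max_of_le_left ?_⟩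
  have := hC ⟨x, hx⟩
  rwa [show ‖NormedSpace.inclusionInDoubleDual 𝕜 E x‖ = ‖x‖ from
    (NormedSpace.inclusionInDoubleDualLi 𝕜).norm_map x] at this

theorem Submodule.isClosed_toWeakSpace_image (S : Submodule 𝕜 E) (hS : IsClosed (S : Set E)) :
    IsClosed (toWeakSpace 𝕜 E '' S) := by
  let _ : NormedSpace ℝ E := NormedSpace.restrictScalars ℝ 𝕜 E
  have : IsScalarTower ℝ 𝕜 E := RestrictScalars.isScalarTower ℝ 𝕜 E
  have h := Convex.toWeakSpace_closure (𝕜 := 𝕜) (s := (S : Set E))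
    (S.restrictScalars ℝ).convex
  rw [hS.closure_eq] at h
  rw [h]
  exact isClosed_closure

theorem IsWeaklyCompact.inter_submodule {A : Set E} (hA : IsWeaklyCompact 𝕜 A)
    (S : Submodule 𝕜 E) (hS : IsClosed (S : Set E)) : IsWeaklyCompact 𝕜 (A ∩ S) := by
  unfold IsWeaklyCompact at *
  rw [Set.image_inter (toWeakSpace 𝕜 E).injective]
  exact hA.inter_right (S.isClosed_toWeakSpace_image hS)

theorem IsWeaklyCompact.image {A : Set E} (hA : IsWeaklyCompact 𝕜 A) (U : E →L[𝕜] F) :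
    IsWeaklyCompact 𝕜 (U '' A) := by
  have h := IsCompact.image hA (WeakSpace.map U).continuous
  rw [Set.image_image] at h
  rw [IsWeaklyCompact, Set.image_image]
  exact h

theorem IsWeaklyCompact.isClosed {A : Set E} (hA : IsWeaklyCompact 𝕜 A) : IsClosed A := by
  have : T2Space (WeakSpace 𝕜 E) := inferInstance
  have h := (IsCompact.isClosed hA).preimage (toWeakSpaceCLM 𝕜 E).continuous
  convert h using 1
  exact ((toWeakSpace 𝕜 E).injective.preimage_image A).symm

end WeakTopology

/-! ### A Schur-type theorem by Baire category. -/

theorem continuous_tsum_indicator_of_summable {E : Type*} [NormedAddCommGroup E]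
    [CompleteSpace E] {b : ℕ → E} (hb : Summable fun n => ‖b n‖) :
    Continuous fun s : ℕ → Bool => ∑' n, if s n then b n else 0 := by
  refine continuous_tsum (fun n => ?_) hb fun n s => ?_
  · exact (continuous_of_discreteTopology (f := fun t : Bool => if t then b n else 0)).comp
      (continuous_apply n)
  · split_ifs <;> simp

/-- A form of Schur's theorem: on a compact space, a sequence of functions all of whose subsums
are continuous converges to zero uniformly. -/
theorem tendsto_eval_of_continuous_subsums {α E : Type*} [TopologicalSpace α] [CompactSpace α]
    [NormedAddCommGroup E] [CompleteSpace E] (b : ℕ → α → E) (hcont : ∀ n, Continuous (b n))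
    (hsum : ∀ x, Summable fun n => ‖b n x‖)
    (hφ : ∀ s : ℕ → Bool, Continuous fun x => ∑' n, if s n then b n x else 0)
    (a : ℕ → α) {δ : ℝ} (hδ : 0 < δ) : ∃ n, ‖b n (a n)‖ < δ := by
  by_contra! hge
  set B : α → ℕ → E := fun x n => b n x with hB
  have hBc : Continuous B := continuous_pi hcont
  -- `α` need not be sequentially compact, but its image in the metrizable space `ℕ → E` is.
  obtain ⟨_, ⟨x, -, rfl⟩, k, hk, hlim⟩ := (isCompact_range hBc).tendsto_subseq
    (fun n => Set.mem_range_self (a n))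
  -- A continuous surjection from a compact space to a Hausdorff one is a quotient map. The subsums
  -- depend only on `B x`, so they descend to continuous functions on the range.
  have hq : IsQuotientMap (Set.rangeFactorization B) := by
    have hc : Continuous (Set.rangeFactorization B) := hBc.subtype_mk _
    exact hc.isClosedMap.isQuotientMap hc Set.rangeFactorization_surjective
  have hlim' : ∀ s : ℕ → Bool, Tendsto (fun j => ∑' n, if s n then b n (a (k j)) else 0) atTop
      (𝓝 (∑' n, if s n then b n x else 0)) := by
    intro s
    have hc : Continuous fun q : Set.range B => ∑' n, if s n then q.1 n else 0 :=
      hq.continuous_iff.2 (hφ s)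
    have hl : Tendsto (fun j => Set.rangeFactorization B (a (k j))) atTop
        (𝓝 (Set.rangeFactorization B x)) := tendsto_subtype_rng.2 hlim
    exact (hc.tendsto _).comp hl
  -- These closed sets cover the Cantor space, so one of them has an interior point `s`.
  set N : ℕ → Set (ℕ → Bool) := fun J => ⋂ j ≥ J,
    {s | dist (∑' n, if s n then b n (a (k j)) else 0) (∑' n, if s n then b n x else 0) ≤ δ / 8}
    with hN
  have hNclosed : ∀ J, IsClosed (N J) := fun J => isClosed_biInter fun j _ =>
    isClosed_le ((continuous_tsum_indicator_of_summable (hsum _)).dist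
      (continuous_tsum_indicator_of_summable (hsum _))) continuous_const
  have hNunion : ⋃ J, N J = Set.univ := by
    refine Set.eq_univ_of_forall fun s => Set.mem_iUnion.2 ?_
    obtain ⟨J, hJ⟩ := Metric.tendsto_atTop.1 (hlim' s) (δ / 8) (by positivity)
    exact ⟨J, Set.mem_iInter₂.2 fun j hj => (hJ j hj).le⟩
  obtain ⟨J, s, hs⟩ := nonempty_interior_of_iUnion_of_closed hNclosed hNunion
  -- Flipping a far coordinate of `s` stays in `N J`, while it changes a subsum by exactly one term
  -- up to sign. The final estimate is δ/8 + δ/8 + δ/2 < δ.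
  have hev : ∀ᶠ n in atTop, Function.update s n (!(s n)) ∈ N J := by
    have ht : Tendsto (fun n => Function.update s n (!(s n))) atTop (𝓝 s) := by
      rw [tendsto_pi_nhds]
      intro i
      refine tendsto_const_nhds.congr' ?_
      filter_upwards [eventually_gt_atTop i] with n hn
      rw [Function.update_of_ne hn.ne]
    exact (ht (mem_interior_iff_mem_nhds.1 hs))
  have hflip : ∀ (c : ℕ → E), Summable (fun n => ‖c n‖) → ∀ n,
      ‖c n‖ = ‖(∑' m, if Function.update s n (!(s n)) m then c m else 0)
        - ∑' m, if s m then c m else 0‖ := by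
    intro c hc n
    have hS : ∀ t : ℕ → Bool, Summable fun m => if t m then c m else 0 := fun t =>
      Summable.of_norm_bounded hc fun m => by split_ifs <;> simp
    rw [← (hS _).tsum_sub (hS _), tsum_eq_single n]
    · cases s n <;> simp
    · intro m hm
      simp [Function.update_of_ne hm]
  have hzero := (hsum x).tendsto_atTop_zero
  obtain ⟨m, hm, hmx, hmJ⟩ := ((hk.tendsto_atTop.eventually hev).and
    ((hk.tendsto_atTop.eventually (hzero.eventually (gt_mem_nhds (show 0 < δ / 2 by positivity)))).and
      (eventually_ge_atTop J))).exists
  have h1 := Set.mem_iInter₂.1 hm m hmJ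
  have h2 := Set.mem_iInter₂.1 (interior_subset hs) m hmJ
  simp only [Set.mem_ofPred_eq, dist_eq_norm] at h1 h2
  have e1 := hge (k m)
  have hcc : Summable fun n => ‖b n (a (k m)) - b n x‖ :=
    Summable.of_nonneg_of_le (fun _ => norm_nonneg _) (fun _ => norm_sub_le _ _)
      ((hsum _).add (hsum _))
  have hS : ∀ (y : α) (t : ℕ → Bool), Summable fun m => if t m then b m y else 0 := fun y t =>
      Summable.of_norm_bounded (hsum y) fun m => by split_ifs <;> simp
  have e2 := hflip _ hcc (k m)
  have e3 : ∀ t : ℕ → Bool, (∑' m_1, if t m_1 then b m_1 (a (k m)) - b m_1 x else 0) =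
      (∑' n, if t n then b n (a (k m)) else 0) - ∑' n, if t n then b n x else 0 := by
    intro t
    rw [← (hS _ t).tsum_sub (hS _ t)]
    congr 1 with n
    split_ifs <;> simp
  rw [e3, e3] at e2
  have e4 := norm_sub_le ((∑' n, if Function.update s (k m) (!(s (k m))) n then b n (a (k m)) else 0)
    - ∑' n, if Function.update s (k m) (!(s (k m))) n then b n x else 0)
    ((∑' n, if s n then b n (a (k m)) else 0) - ∑' n, if s n then b n x else 0)
  have e5 := norm_le_norm_sub_add (b (k m) (a (k m))) (b (k m) x)
  linarith

/-! ### Equi-integrability of weakly compact sets in L¹. -/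

section EquiIntegrable

variable {Ω : Type*} [MeasurableSpace Ω] {μ : Measure Ω} {𝕜 : Type*} [RCLike 𝕜]

theorem exists_dual_eq_integral_mul (w : Ω → 𝕜) (hw : AEStronglyMeasurable w μ) (C : ℝ)
    (hC : ∀ᵐ x ∂μ, ‖w x‖ ≤ C) :
    ∃ T : StrongDual 𝕜 (Lp 𝕜 1 μ), ∀ f : Lp 𝕜 1 μ, T f = ∫ x, w x * f x ∂μ := by
  have hm : MemLp w ⊤ μ := memLp_top_of_bound hw C hC
  refine ⟨(ContinuousLinearMap.mul 𝕜 𝕜).lpPairing μ ⊤ 1 hm.toLp, fun f => ?_⟩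
  rw [ContinuousLinearMap.lpPairing_eq_integral]
  refine integral_congr_ae ?_
  filter_upwards [hm.coeFn_toLp] with x hx
  simp [hx]

theorem exists_dual_eq_setIntegral_mul (w : Ω → 𝕜) (hw : Measurable w) (C : ℝ)
    (hC : ∀ x, ‖w x‖ ≤ C) {D : Set Ω} (hD : MeasurableSet D) :
    ∃ T : StrongDual 𝕜 (Lp 𝕜 1 μ), ∀ f : Lp 𝕜 1 μ, T f = ∫ x in D, w x * f x ∂μ := by
  obtain ⟨T, hT⟩ := exists_dual_eq_integral_mul (μ := μ) (D.indicator w)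
    (hw.indicator hD).aestronglyMeasurable C
    (.of_forall fun x => (norm_indicator_le_norm_self _ _).trans (hC x))
  refine ⟨T, fun f => ?_⟩
  rw [hT, ← integral_indicator hD]
  congr 1 with x
  by_cases hx : x ∈ D <;> simp [hx]

/-- The conjugate signs of the `f n` on the disjoint `S n` glue to one bounded multiplier `w`.
Subsums of the integrals of w f over the `S n` are integrals over unions, hence weakly continuous in
f, and the Schur-type theorem applies. -/
theorem IsWeaklyCompact.exists_setIntegral_norm_lt_of_pairwise_disjoint {A : Set (Lp 𝕜 1 μ)}
    (hA : IsWeaklyCompact 𝕜 A) {f : ℕ → Lp 𝕜 1 μ} (hf : ∀ n, f n ∈ A) {S : ℕ → Set Ω}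
    (hS : ∀ n, MeasurableSet (S n)) (hdisj : Pairwise (Function.onFun Disjoint S))
    {δ : ℝ} (hδ : 0 < δ) : ∃ n, ∫ x in S n, ‖f n x‖ ∂μ < δ := by
  obtain ⟨p, hp, hpS⟩ := exists_measurable_piecewise S hS (fun n => (f n : Ω → 𝕜))
    (fun n => (Lp.stronglyMeasurable (f n)).measurable) (fun i j hij x hx =>
      ((hdisj hij).le_bot hx).elim)
  set w : Ω → 𝕜 := fun x => (starRingEnd 𝕜) (p x) / ‖p x‖ with hw
  have hwm : Measurable w := by
    have := RCLike.continuous_conj (K := 𝕜)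
    have h2 := RCLike.continuous_ofReal (K := 𝕜)
    exact (this.measurable.comp hp).div (h2.measurable.comp hp.norm)
  have hw1 : ∀ x, ‖w x‖ ≤ 1 := fun x => by
    simp only [hw, norm_div, RCLike.norm_conj, RCLike.norm_ofReal, abs_norm]
    exact div_self_le_one _
  have hwp : ∀ x, w x * p x = (‖p x‖ : 𝕜) := fun x => by
    simp only [hw]
    rcases eq_or_ne (p x) 0 with h | h
    · simp [h]
    · rw [div_mul_eq_mul_div, RCLike.conj_mul, sq, mul_div_assoc, div_self, mul_one]
      simpa using h
  have hint : ∀ x : Lp 𝕜 1 μ, Integrable (fun t => w t * x t) μ := fun x =>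
    (L1.integrable_coeFn x).bdd_mul (c := 1) hwm.aestronglyMeasurable (.of_forall hw1)
  have hcompact : CompactSpace (toWeakSpace 𝕜 (Lp 𝕜 1 μ) '' A) := isCompact_iff_compactSpace.1 hA
  set g : toWeakSpace 𝕜 (Lp 𝕜 1 μ) '' A → Lp 𝕜 1 μ :=
    fun x => (toWeakSpace 𝕜 (Lp 𝕜 1 μ)).symm x with hg
  have hTc : ∀ D, MeasurableSet D → Continuous fun x => ∫ t in D, w t * g x t ∂μ := by
    intro D hD
    obtain ⟨T, hT⟩ := exists_dual_eq_setIntegral_mul (μ := μ) w hwm 1 hw1 hD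
    simp_rw [← hT]
    exact T.continuous_weakSpace.comp continuous_subtype_val
  have hsums : ∀ x : Lp 𝕜 1 μ, Summable fun n => ∫ t in S n, ‖x t‖ ∂μ := fun x =>
    (hasSum_integral_iUnion hS hdisj (L1.integrable_coeFn x).norm.integrableOn).summable
  obtain ⟨n, hn⟩ := tendsto_eval_of_continuous_subsums (fun n x => ∫ t in S n, w t * g x t ∂μ)
    (fun n => hTc _ (hS n))
    (fun x => by
      refine Summable.of_nonneg_of_le (fun _ => norm_nonneg _) (fun n => ?_) (hsums (g x))
      refine norm_integral_le_of_norm_le (L1.integrable_coeFn (g x)).norm.integrableOn ?_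
      refine .of_forall fun t => ?_
      rw [norm_mul]
      exact mul_le_of_le_one_left (norm_nonneg _) (hw1 t))
    (fun s => by
      set D : ℕ → Set Ω := fun n => if s n then S n else ∅ with hD
      have hDm : ∀ n, MeasurableSet (D n) := fun n => by
        simp only [hD]; split_ifs <;> simp [hS]
      have hDd : Pairwise (Function.onFun Disjoint D) := fun i j hij => by
        simp only [hD, Function.onFun]
        split_ifs <;> simp [hdisj hij]
      convert hTc (⋃ n, D n) (MeasurableSet.iUnion hDm) using 2 with x
      rw [← (hasSum_integral_iUnion hDm hDd (hint (g x)).integrableOn).tsum_eq]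
      congr 1 with n
      simp only [hD]
      split_ifs <;> simp)
    (fun n => ⟨toWeakSpace 𝕜 _ (f n), f n, hf n, rfl⟩) hδ
  refine ⟨n, ?_⟩
  convert hn using 1
  have h1 : ∫ t in S n, w t * g ⟨toWeakSpace 𝕜 _ (f n), f n, hf n, rfl⟩ t ∂μ =
      ∫ t in S n, (‖f n t‖ : 𝕜) ∂μ := by
    refine setIntegral_congr_fun (hS n) fun t ht => ?_
    have := hwp t
    rw [hpS n ht] at this
    simpa [hg] using this
  rw [h1, integral_ofReal, RCLike.norm_ofReal,
    abs_of_nonneg (integral_nonneg fun _ => norm_nonneg _)]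

/-- A weakly compact subset of `L¹` is equi-integrable. -/
theorem IsWeaklyCompact.exists_integrable_setIntegral_norm_le {A : Set (Lp 𝕜 1 μ)}
    (hA : IsWeaklyCompact 𝕜 A) {ε : ℝ} (hε : 0 < ε) :
    ∃ G : Ω → ℝ, Measurable G ∧ Integrable G μ ∧ (∀ x, 0 ≤ G x) ∧
      ∀ f ∈ A, ∫ x in {x | G x < ‖f x‖}, ‖f x‖ ∂μ ≤ ε := by
  by_contra! hcon
  obtain ⟨R, hR, hAR⟩ := hA.exists_norm_le
  -- Chosen so that ∑ R K^{-(i+1)} = R / (K - 1) = ε / 2.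
  set K : ℝ := 1 + 2 * R / ε with hK
  have hK1 : 1 < K := by rw [hK]; linarith [show 0 < 2 * R / ε by positivity]
  have hK0 : 0 < K := by linarith
  let D := {G : Ω → ℝ // Measurable G ∧ Integrable G μ ∧ ∀ x, 0 ≤ G x}
  have hmeas : ∀ f : Lp 𝕜 1 μ, Measurable fun x => ‖f x‖ := fun f =>
    (Lp.stronglyMeasurable f).measurable.norm
  have hintn : ∀ f : Lp 𝕜 1 μ, Integrable (fun x => ‖f x‖) μ := fun f =>
    (L1.integrable_coeFn f).norm
  choose F hFA hF using fun G : D => hcon G.1 G.2.1 G.2.2.1 G.2.2.2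
  -- Recursion G₀ = 0, G_{n+1} = K (G_n + |f_n|), where f_n ∈ A violates the bound for G_n. On a
  -- later set S_{n+1+i} this forces |f_n| ≤ K^{-(i+1)} |f_{n+1+i}|.
  let G : ℕ → D := fun n => Nat.rec ⟨fun _ => 0, measurable_const, integrable_zero _ _ _,
    fun _ => le_rfl⟩ (fun _ H => ⟨fun x => K * (H.1 x + ‖F H x‖),
      (H.2.1.add (hmeas _)).const_mul K, (H.2.2.1.add (hintn _)).const_mul K,
      fun x => mul_nonneg hK0.le (add_nonneg (H.2.2.2 x) (norm_nonneg _))⟩) n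
  set f : ℕ → Lp 𝕜 1 μ := fun n => F (G n) with hf
  have hGs : ∀ n x, (G (n + 1)).1 x = K * ((G n).1 x + ‖f n x‖) := fun n x => rfl
  have hGge : ∀ n i x, K ^ (i + 1) * ‖f n x‖ ≤ (G (n + 1 + i)).1 x := by
    intro n i x
    induction i with
    | zero =>
      rw [add_zero, hGs, zero_add, pow_one]
      exact mul_le_mul_of_nonneg_left (by linarith [(G n).2.2.2 x]) hK0.le
    | succ i ih =>
      rw [← add_assoc, hGs, pow_succ', mul_assoc]
      exact mul_le_mul_of_nonneg_left (by linarith [norm_nonneg (f (n + 1 + i) x)]) hK0.le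
  set S : ℕ → Set Ω := fun n => {x | (G n).1 x < ‖f n x‖} with hSdef
  have hSm : ∀ n, MeasurableSet (S n) := fun n => measurableSet_lt (G n).2.1 (hmeas _)
  -- Removing all later sets makes the `T n` disjoint and costs at most ε/2 of an integral larger
  -- than ε.
  set T : ℕ → Set Ω := fun n => S n \ ⋃ i, S (n + 1 + i) with hT
  have hTm : ∀ n, MeasurableSet (T n) := fun n =>
    (hSm n).diff (MeasurableSet.iUnion fun i => hSm _)
  have hTd : Pairwise (Function.onFun Disjoint T) := by
    rw [pairwise_disjoint_on]
    intro m n hmn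
    rw [Set.disjoint_left]
    rintro x ⟨-, hx⟩ ⟨hx', -⟩
    refine hx (Set.mem_iUnion.2 ⟨n - (m + 1), ?_⟩)
    rwa [Nat.add_sub_cancel' hmn]
  have hsmall : ∀ n i, ∫ x in S (n + 1 + i), ‖f n x‖ ∂μ ≤ R * K⁻¹ ^ (i + 1) := by
    intro n i
    have h1 : ∫ x in S (n + 1 + i), ‖f n x‖ ∂μ ≤
        ∫ x in S (n + 1 + i), K⁻¹ ^ (i + 1) * ‖f (n + 1 + i) x‖ ∂μ := by
      refine setIntegral_mono_on (hintn _).integrableOn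
        ((hintn _).const_mul _).integrableOn (hSm _) fun x hx => ?_
      have := (hGge n i x).trans (le_of_lt hx)
      rw [inv_pow, inv_mul_eq_div, le_div_iff₀ (by positivity), mul_comm]
      exact this
    refine h1.trans ?_
    rw [integral_const_mul, mul_comm]
    refine mul_le_mul_of_nonneg_right ?_ (by positivity)
    refine (setIntegral_le_integral (hintn _) (.of_forall fun _ => norm_nonneg _)).trans ?_
    rw [← L1.norm_eq_integral_norm]
    exact hAR _ (hFA _)
  have hgeom : HasSum (fun i : ℕ => R * K⁻¹ ^ (i + 1)) (ε / 2) := by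
    have h1 := (hasSum_geometric_of_lt_one (inv_nonneg.2 hK0.le) (inv_lt_one_of_one_lt₀ hK1)).mul_left
      (R * K⁻¹)
    have h2 : R * K⁻¹ * (1 - K⁻¹)⁻¹ = ε / 2 := by
      have : K - 1 = 2 * R / ε := by rw [hK]; ring
      rw [mul_assoc, ← mul_inv, mul_sub, mul_one, mul_inv_cancel₀ hK0.ne', this]
      field_simp
    rw [h2] at h1
    simpa only [pow_succ', ← mul_assoc] using h1
  have hunion : ∀ n, ∫ x in ⋃ i, S (n + 1 + i), ‖f n x‖ ∂μ ≤ ε / 2 := by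
    intro n
    rw [integral_eq_lintegral_of_nonneg_ae (.of_forall fun _ => norm_nonneg _)
      (hmeas _).aestronglyMeasurable]
    refine ENNReal.toReal_le_of_le_ofReal (by positivity) ?_
    refine (lintegral_iUnion_le _ _).trans ?_
    rw [← hgeom.tsum_eq, ENNReal.ofReal_tsum_of_nonneg (fun i => by positivity) hgeom.summable]
    refine ENNReal.tsum_le_tsum fun i => ?_
    rw [← ofReal_integral_eq_lintegral_ofReal (hintn _).integrableOn
      (.of_forall fun _ => norm_nonneg _)]
    exact ENNReal.ofReal_le_ofReal (hsmall n i)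
  obtain ⟨n, hn⟩ := hA.exists_setIntegral_norm_lt_of_pairwise_disjoint (f := f)
    (fun n => hFA _) hTm hTd (half_pos hε)
  have h1 : ∫ x in S n, ‖f n x‖ ∂μ ≤
      ∫ x in T n, ‖f n x‖ ∂μ + ∫ x in ⋃ i, S (n + 1 + i), ‖f n x‖ ∂μ := by
    have hU : MeasurableSet (⋃ i, S (n + 1 + i)) := MeasurableSet.iUnion fun i => hSm _
    rw [← setIntegral_union Set.disjoint_sdiff_left hU (hintn _).integrableOn
      (hintn _).integrableOn, Set.sdiff_union_self]
    exact setIntegral_mono_set (hintn _).integrableOn (.of_forall fun _ => norm_nonneg _)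
      (Set.subset_union_left).eventuallyLE
  have h2 := hF (G n)
  have h3 := hunion n
  linarith

end EquiIntegrable

/-! ### Densities of functionals and their averages. -/

section Representation

variable {X : Type*} [MeasurableSpace X] {ν : Measure X} {𝕜 : Type*} [RCLike 𝕜]

/-- On bounded functions, a continuous functional on `L¹` of a finite measure is given by
integration against an integrable function. -/
theorem exists_integrable_forall_dual_eq_integral [IsFiniteMeasure ν]
    (l : StrongDual 𝕜 (Lp 𝕜 1 ν)) :
    ∃ h : X → 𝕜, StronglyMeasurable h ∧ Integrable h ν ∧
      ∀ f : Lp 𝕜 1 ν, (∃ C : ℝ, ∀ᵐ x ∂ν, ‖f x‖ ≤ C) → l f = ∫ x, f x * h x ∂ν := by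
  let ι : Lp 𝕜 2 ν →L[𝕜] Lp 𝕜 1 ν :=
    (ContinuousLinearMap.mul 𝕜 𝕜).holderL ν 2 2 1 ((memLp_const (1 : 𝕜)).toLp)
  have hι : ∀ f, ι f =ᵐ[ν] f := fun f => by
    have h1 := (ContinuousLinearMap.mul 𝕜 𝕜).coeFn_holder (r := 1)
      ((memLp_const (1 : 𝕜)).toLp (μ := ν) (p := 2)) f
    filter_upwards [h1, (memLp_const (1 : 𝕜)).coeFn_toLp (μ := ν) (p := 2)] with x h1 h2
    simp only [ι, ContinuousLinearMap.holderL_apply_apply]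
    rw [h1, h2]
    simp
  -- Riesz representation in L², which embeds in L¹ since the measure is finite; the density is the
  -- conjugate of `k`.
  set k : Lp 𝕜 2 ν := (InnerProductSpace.toDual 𝕜 (Lp 𝕜 2 ν)).symm (l ∘L ι) with hk
  have hk2 : MemLp (fun x => (starRingEnd 𝕜) (k x)) 2 ν := (Lp.memLp k).star
  refine ⟨fun x => (starRingEnd 𝕜) (k x),
    RCLike.continuous_conj.comp_stronglyMeasurable (Lp.stronglyMeasurable k),
    hk2.integrable one_le_two, ?_⟩
  rintro f ⟨C, hC⟩
  have hf : MemLp f 2 ν := MemLp.of_bound (Lp.aestronglyMeasurable f) C hC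
  have h1 : ι hf.toLp = f := Lp.ext ((hι _).trans hf.coeFn_toLp)
  have h2 : inner 𝕜 k hf.toLp = l f := by
    rw [hk, InnerProductSpace.toDual_symm_apply, ContinuousLinearMap.comp_apply, h1]
  rw [← h2, L2.inner_def]
  refine integral_congr_ae ?_
  filter_upwards [hf.coeFn_toLp] with x hx
  rw [hx, RCLike.inner_apply]

/-- A function with values in a countable product lies in a closed set almost everywhere as soon
as all its averages do. -/
theorem ae_mem_of_forall_setAverage_mem [IsFiniteMeasure ν] {h : ℕ → X → 𝕜}
    (hm : ∀ k, Measurable (h k)) (hi : ∀ k, Integrable (h k) ν) {Q : Set (ℕ → 𝕜)}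
    (hQ : IsClosed Q) (hav : ∀ S, MeasurableSet S → ν S ≠ 0 → (fun k => ⨍ x in S, h k x ∂ν) ∈ Q) :
    ∀ᵐ x ∂ν, (fun k => h k x) ∈ Q := by
  set H : X → ℕ → 𝕜 := fun x k => h k x with hH
  have hHm : Measurable H := measurable_pi_lambda _ hm
  by_contra hcon
  have h0 : (ν.map H) Qᶜ ≠ 0 := by
    rw [Measure.map_apply hHm hQ.measurableSet.compl]
    exact hcon
  -- Every neighbourhood of `z` has positive image measure. A closed box around `z` that misses `Q`
  -- is convex, so the averages of `H` over its preimage stay in it, contradicting `hav`.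
  obtain ⟨z, hz, hpos⟩ := exists_mem_forall_mem_nhdsWithin_pos_measure h0
  rw [hQ.isOpen_compl.nhdsWithin_eq hz] at hpos
  obtain ⟨⟨I, r⟩, ⟨hI, hr⟩, hsub⟩ := (Filter.hasBasis_pi
    (fun i : ℕ => Metric.nhds_basis_closedBall (x := z i))).mem_iff.1
    (nhds_pi (a := z) ▸ hQ.isOpen_compl.mem_nhds hz)
  set W : Set (ℕ → 𝕜) := I.pi fun i => Metric.closedBall (z i) (r i) with hW
  have hWn : W ∈ 𝓝 z := set_pi_mem_nhds hI fun i hi => Metric.closedBall_mem_nhds _ (hr i hi)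
  have hWm : MeasurableSet W := MeasurableSet.pi hI.countable fun i _ => measurableSet_closedBall
  have hS := (hpos W hWn).ne'
  rw [Measure.map_apply hHm hWm] at hS
  refine hsub ?_ (hav _ (hHm hWm) hS)
  intro i hi'
  refine (convex_closedBall (z i) (r i)).set_average_mem Metric.isClosed_closedBall hS
    (measure_ne_top _ _) ?_ (hi i).integrableOn
  filter_upwards [ae_restrict_mem (hHm hWm)] with x hx using hx i hi'

end Representation

/-! ### Images of the unit ball of L^∞ for a finite measure. -/

theorem Metric.totallyBounded_of_forall_exists_dist_le {α : Type*} [PseudoMetricSpace α]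
    {s : Set α} (h : ∀ ε > 0, ∃ K, TotallyBounded K ∧ ∀ x ∈ s, ∃ y ∈ K, dist x y ≤ ε) :
    TotallyBounded s := by
  refine Metric.totallyBounded_iff.2 fun ε hε => ?_
  obtain ⟨K, hK, hsK⟩ := h (ε / 2) (half_pos hε)
  obtain ⟨t, ht, hKt⟩ := Metric.totallyBounded_iff.1 hK (ε / 2) (half_pos hε)
  refine ⟨t, ht, fun x hx => ?_⟩
  obtain ⟨y, hy, hxy⟩ := hsK x hx
  obtain ⟨z, hz, hyz⟩ := Set.mem_iUnion₂.1 (hKt hy)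
  refine Set.mem_iUnion₂.2 ⟨z, hz, ?_⟩
  rw [Metric.mem_ball] at *
  linarith [dist_triangle x y z]

theorem exists_norming_sequence {𝕜 : Type*} [RCLike 𝕜] {F : Type*} [NormedAddCommGroup F]
    [NormedSpace 𝕜 F] {d : ℕ → F} {S : Set F} (hd : S ⊆ closure (Set.range d)) :
    ∃ y : ℕ → StrongDual 𝕜 F, (∀ k, ‖y k‖ ≤ 1) ∧
      ∀ x ∈ S, ∀ a : ℝ, (∀ k, ‖y k x‖ ≤ a) → ‖x‖ ≤ a := by
  choose y hy hyd using fun k => exists_dual_vector'' 𝕜 (d k)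
  refine ⟨y, hy, fun x hx a ha => le_of_forall_pos_le_add fun ε hε => ?_⟩
  obtain ⟨_, ⟨k, rfl⟩, hk⟩ := Metric.mem_closure_iff.1 (hd hx) (ε / 2) (half_pos hε)
  rw [dist_eq_norm] at hk
  have h1 : ‖d k‖ ≤ ‖y k x‖ + ‖x - d k‖ := by
    have h2 : ‖y k (d k)‖ = ‖d k‖ := by rw [hyd]; simp
    have h3 := norm_sub_le (y k x) (y k (x - d k))
    rw [← map_sub, sub_sub_cancel, h2] at h3
    have h4 := (y k).le_of_opNorm_le (hy k) (x - d k)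
    linarith
  have h5 := norm_le_norm_add_norm_sub' x (d k)
  linarith [ha k]

section Bounded

variable {X : Type*} [MeasurableSpace X] {ν : Measure X} {𝕜 : Type*} [RCLike 𝕜]
  {F : Type*} [NormedAddCommGroup F] [NormedSpace 𝕜 F]

/-- The functions representing `y k ∘ V` are almost everywhere the coordinates of a point of any
weakly compact set containing the image of the unit ball. -/
theorem ae_exists_mem_forall_dual_eq [IsFiniteMeasure ν] (V : Lp 𝕜 1 ν →L[𝕜] F) {C : Set F}
    (hC : IsWeaklyCompact 𝕜 C) (hVC : ∀ f, ‖f‖ ≤ 1 → V f ∈ C) (y : ℕ → StrongDual 𝕜 F)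
    {h : ℕ → X → 𝕜} (hm : ∀ k, Measurable (h k)) (hi : ∀ k, Integrable (h k) ν)
    (hh : ∀ k, ∀ f : Lp 𝕜 1 ν, (∃ M : ℝ, ∀ᵐ x ∂ν, ‖f x‖ ≤ M) →
      y k (V f) = ∫ x, f x * h k x ∂ν) :
    ∀ᵐ x ∂ν, ∃ c ∈ C, ∀ k, y k c = h k x := by
  have hQ := (hC.isCompact_image_of_forall_dual y).isClosed
  refine (ae_mem_of_forall_setAverage_mem hm hi hQ fun S hS hS0 => ?_).mono ?_
  · have hpos : 0 < ν.real S := by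
      rw [measureReal_def]; exact ENNReal.toReal_pos hS0 (measure_ne_top _ _)
    -- The normalized indicator of `S` has L¹ norm 1, and `y k ∘ V` sends it to the average of `h k`
    -- over `S`.
    set c : 𝕜 := (((ν.real S)⁻¹ : ℝ) : 𝕜) with hc
    set f : Lp 𝕜 1 ν := indicatorConstLp 1 hS (measure_ne_top ν S) c with hf
    have hf' : f =ᵐ[ν] S.indicator fun _ => c := indicatorConstLp_coeFn
    refine ⟨V f, hVC f ?_, ?_⟩
    · rw [hf, norm_indicatorConstLp one_ne_zero ENNReal.one_ne_top, hc, RCLike.norm_ofReal,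
        abs_of_pos (inv_pos.2 hpos)]
      simp [inv_mul_cancel₀ hpos.ne']
    · funext k
      show y k (V f) = _
      rw [hh k f ⟨‖c‖, ?_⟩, setAverage_eq]
      · have : (fun x => f x * h k x) =ᵐ[ν] S.indicator fun x => c * h k x := by
          filter_upwards [hf'] with x hx
          rw [hx]
          by_cases hxS : x ∈ S <;> simp [hxS]
        rw [integral_congr_ae this, integral_indicator hS, integral_const_mul, hc,
          RCLike.real_smul_eq_coe_mul]
      · filter_upwards [hf'] with x hx
        rw [hx]
        exact norm_indicator_le_norm_self _ _
  · rintro x ⟨c, hcC, hc⟩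
    exact ⟨c, hcC, fun k => congrFun hc k⟩

/-- The compactness part of the Dunford–Pettis–Phillips theorem: a weakly compact operator with
separable range on `L¹` of a finite measure is compact on `L^∞`. -/
theorem totallyBounded_image_of_ae_norm_le_one [IsFiniteMeasure ν] (V : Lp 𝕜 1 ν →L[𝕜] F)
    (hsep : TopologicalSpace.IsSeparable (Set.range V)) {C : Set F}
    (hC : IsWeaklyCompact 𝕜 C) (hVC : ∀ f, ‖f‖ ≤ 1 → V f ∈ C) :
    TotallyBounded (V '' {f | ∀ᵐ x ∂ν, ‖f x‖ ≤ 1}) := by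
  set F₀ : Submodule 𝕜 F := (LinearMap.range V.toLinearMap).topologicalClosure with hF₀
  have hF₀c : IsClosed (F₀ : Set F) := Submodule.isClosed_topologicalClosure _
  have hVF₀ : ∀ f, V f ∈ F₀ := fun f => Submodule.le_topologicalClosure _ ⟨f, rfl⟩
  have hF₀s : TopologicalSpace.SeparableSpace F₀ := by
    have h1 : TopologicalSpace.IsSeparable (F₀ : Set F) := by
      rw [hF₀, Submodule.topologicalClosure_coe]
      exact TopologicalSpace.IsSeparable.closure (by rw [LinearMap.coe_range]; exact hsep)
    exact h1.separableSpace
  set d : ℕ → F := fun n => TopologicalSpace.denseSeq F₀ n with hd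
  have hdF₀ : ∀ n, d n ∈ F₀ := fun n => (TopologicalSpace.denseSeq F₀ n).2
  have hdd : ∀ x ∈ F₀, ∀ ε > 0, ∃ n, ‖x - d n‖ < ε := by
    intro x hx ε hε
    obtain ⟨n, hn⟩ := (TopologicalSpace.denseRange_denseSeq F₀).exists_dist_lt ⟨x, hx⟩ hε
    exact ⟨n, by simpa [Subtype.dist_eq, dist_eq_norm] using hn⟩
  obtain ⟨y, hy, hyn⟩ := exists_norming_sequence (𝕜 := 𝕜) (d := d) (S := (F₀ : Set F))
    (fun x hx => Metric.mem_closure_iff.2 fun ε hε => by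
      obtain ⟨n, hn⟩ := hdd x hx ε hε
      exact ⟨d n, ⟨n, rfl⟩, by rwa [dist_eq_norm]⟩)
  choose h hsm hi hh using fun k => exists_integrable_forall_dual_eq_integral ((y k).comp V)
  have hae := ae_exists_mem_forall_dual_eq V (hC.inter_submodule F₀ hF₀c)
    (fun f hf => ⟨hVC f hf, hVF₀ f⟩) y (fun k => (hsm k).measurable) hi hh
  obtain ⟨R, hR, hCR⟩ := hC.exists_norm_le
  refine Metric.totallyBounded_of_forall_exists_dist_le fun ε₀ hε₀ => ?_
  set M : ℝ := ν.real Set.univ with hM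
  have hM0 : 0 ≤ M := measureReal_nonneg
  set ε : ℝ := ε₀ / (M + R) with hε
  have hε0 : 0 < ε := by positivity
  -- For a.e. x the values `h k x` are `y k c` with c in the separable `F₀`; some `d j` is ε-close
  -- to c, so x lies in `B j`.
  set B : ℕ → Set X := fun j => {x | ∀ k, ‖h k x - y k (d j)‖ ≤ ε} with hB
  have hBm : ∀ j, MeasurableSet (B j) := fun j => by
    simp only [hB, Set.ofPred_forall]
    exact MeasurableSet.iInter fun k =>
      measurableSet_le (((hsm k).measurable.sub_const _).norm) measurable_const
  have hBae : ∀ᵐ x ∂ν, ∃ j, x ∈ B j := by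
    filter_upwards [hae] with x ⟨c, hc, hcx⟩
    obtain ⟨j, hj⟩ := hdd c hc.2 ε hε0
    refine ⟨j, fun k => ?_⟩
    rw [← hcx, ← map_sub]
    exact ((y k).le_of_opNorm_le (hy k) _).trans (by linarith)
  set P : ℕ → Set X := disjointed B with hP
  have hPm : ∀ j, MeasurableSet (P j) := fun j => MeasurableSet.disjointed hBm j
  set E : ℕ → Set X := fun N => {x | ∀ j < N, x ∉ B j} with hE
  have hEm : ∀ N, MeasurableSet (E N) := fun N => by
    simp only [hE, Set.ofPred_forall]
    exact MeasurableSet.iInter fun j => MeasurableSet.iInter fun _ => (hBm j).compl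
  have hElim : Tendsto (ν ∘ E) atTop (𝓝 0) := by
    have h1 := tendsto_measure_iInter_atTop (μ := ν) (s := E)
      (fun N => (hEm N).nullMeasurableSet)
      (fun m n hmn x hx j hj => hx j (hj.trans_le hmn)) ⟨0, measure_ne_top _ _⟩
    have h2 : ν (⋂ n, E n) = 0 := by
      refine measure_mono_null (fun x hx => ?_) (ae_iff.1 hBae)
      rintro ⟨j, hj⟩
      exact Set.mem_iInter.1 hx (j + 1) j (Nat.lt_succ_self j) hj
    rwa [h2] at h1
  obtain ⟨N, hN⟩ := (hElim.eventually (ge_mem_nhds (ENNReal.ofReal_pos.2 hε0))).exists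
  have hN' : ν.real (E N) ≤ ε := ENNReal.toReal_le_of_le_ofReal hε0.le hN
  -- V f is approximated by ∑ (∫_{P j} f) d j, whose coefficients are bounded by the total mass `M`.
  let L : (Fin N → 𝕜) → F := fun a => ∑ j, a j • d j
  refine ⟨L '' Metric.closedBall 0 M, ((isCompact_closedBall _ _).image
    (by fun_prop)).totallyBounded, ?_⟩
  rintro _ ⟨f, hf, rfl⟩
  have hf' : ∀ᵐ x ∂ν, ‖f x‖ ≤ 1 := hf
  have hfi : Integrable f ν := L1.integrable_coeFn f
  refine ⟨_, ⟨fun j => ∫ x in P j, f x ∂ν, ?_, rfl⟩, ?_⟩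
  · rw [mem_closedBall_zero_iff, pi_norm_le_iff_of_nonneg hM0]
    intro j
    refine (norm_setIntegral_le_of_norm_le_const_ae' (measure_lt_top _ _)
      (hf'.mono fun x hx _ => hx)).trans ?_
    rw [one_mul]
    exact measureReal_mono (Set.subset_univ _)
  · rw [dist_eq_norm]
    refine hyn _ (F₀.sub_mem (hVF₀ f) (F₀.sum_mem fun j _ => F₀.smul_mem _ (hdF₀ _))) _ fun k => ?_
    -- The density of `y k` composed with the finite-rank approximation. It differs from `h k` by at
    -- most ε off `E N` and at most `R` on `E N`, for a total error M ε + R ε = ε₀, uniformly in k.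
    set q : X → 𝕜 := fun x => ∑ j : Fin N, (P j).indicator (fun _ => y k (d j)) x with hq
    have hfh : Integrable (fun x => f x * h k x) ν :=
      (hi k).bdd_mul (c := 1) (Lp.aestronglyMeasurable f) hf'
    have hfP : ∀ j : Fin N, Integrable (fun x => f x * (P j).indicator (fun _ => y k (d j)) x) ν :=
      fun j => ((integrable_const _).indicator (hPm j)).bdd_mul (c := 1)
        (Lp.aestronglyMeasurable f) hf'
    have hfq : Integrable (fun x => f x * q x) ν := by
      simp only [hq, Finset.mul_sum]
      exact integrable_finsetSum _ fun j _ => hfP j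
    have h1 : y k (V f - L fun j => ∫ x in P j, f x ∂ν) = ∫ x, f x * (h k x - q x) ∂ν := by
      simp_rw [mul_sub]
      rw [integral_sub hfh hfq, map_sub]
      congr 1
      · exact hh k f ⟨1, hf'⟩
      · simp only [L, map_sum, map_smul, hq, Finset.mul_sum]
        rw [integral_finsetSum _ fun j _ => hfP j]
        refine Finset.sum_congr rfl fun j _ => ?_
        rw [smul_eq_mul, ← integral_mul_const, ← integral_indicator (hPm j)]
        congr 1 with x
        by_cases hx : x ∈ P j <;> simp [hx]
    rw [h1]
    have hbound : ∀ᵐ x ∂ν, ‖f x * (h k x - q x)‖ ≤ ε + (E N).indicator (fun _ => R) x := by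
      filter_upwards [hf', hae] with x hx ⟨c, hc, hcx⟩
      rw [norm_mul]
      refine (mul_le_of_le_one_left (norm_nonneg _) hx).trans ?_
      by_cases hxE : x ∈ E N
      · have hq0 : q x = 0 := Finset.sum_eq_zero fun j _ =>
          Set.indicator_of_notMem (fun hxj => hxE j j.2 (disjointed_subset B j hxj)) _
        rw [hq0, sub_zero, ← hcx, Set.indicator_of_mem hxE]
        have := (y k).le_of_opNorm_le (hy k) c
        linarith [hCR c hc.1]
      · rw [Set.indicator_of_notMem hxE, add_zero]
        obtain ⟨j, hj, hxj⟩ : ∃ j < N, x ∈ B j := by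
          by_contra! hcon
          exact hxE hcon
        obtain ⟨i, hxi⟩ := Set.mem_iUnion.1
          ((iUnion_disjointed (f := B)).symm ▸ Set.mem_iUnion.2 ⟨j, hxj⟩ : x ∈ ⋃ n, disjointed B n)
        have hij : i ≤ j := by
          by_contra! hlt
          rw [disjointed_eq_inter_compl] at hxi
          exact Set.mem_iInter₂.1 hxi.2 j hlt hxj
        have hqx : q x = y k (d i) := by
          simp only [hq]
          rw [Finset.sum_eq_single_of_mem (⟨i, hij.trans_lt hj⟩ : Fin N) (Finset.mem_univ _)]
          · exact Set.indicator_of_mem hxi _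
          · intro i' _ hne
            refine Set.indicator_of_notMem (fun hx' => ?_) _
            exact (disjoint_disjointed B (fun he => hne (Fin.ext he))).le_bot ⟨hx', hxi⟩
        rw [hqx]
        exact disjointed_subset B i hxi k
    refine (norm_integral_le_of_norm_le ((integrable_const ε).add
      ((integrable_const R).indicator (hEm N))) hbound).trans ?_
    have h3 : ∫ x, ε + (E N).indicator (fun _ => R) x ∂ν = M * ε + ν.real (E N) * R := by
      rw [integral_add (integrable_const ε) ((integrable_const R).indicator (hEm N)),
        integral_indicator (hEm N), setIntegral_const, integral_const]
      simp [hM]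
    refine (le_of_eq h3).trans ?_
    have h4 : ν.real (E N) * R ≤ ε * R := mul_le_mul_of_nonneg_right hN' hR.le
    have h5 : ε * (M + R) = ε₀ := div_mul_cancel₀ _ (by positivity)
    linarith

end Bounded

/-! ### Order intervals in L¹ of an arbitrary measure, by reduction to sequences. -/

theorem Metric.totallyBounded_of_forall_seq {α : Type*} [PseudoMetricSpace α] {s : Set α}
    (h : ∀ u : ℕ → α, (∀ n, u n ∈ s) → ∃ T, TotallyBounded T ∧ ∀ n, u n ∈ T) :
    TotallyBounded s := by
  by_contra hcon
  simp only [Metric.totallyBounded_iff, not_forall, not_exists, not_and] at hcon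
  obtain ⟨ε, hε, hcov⟩ := hcon
  obtain ⟨u, hu⟩ := Set.seq_of_forall_finite_exists (P := fun x t => x ∈ s ∧ ∀ y ∈ t, ε ≤ dist x y)
    fun t ht => by
      obtain ⟨x, hx, hxt⟩ := Set.not_subset.1 (hcov t ht)
      simp only [Set.mem_iUnion, Metric.mem_ball, not_exists, not_lt] at hxt
      exact ⟨x, hx, hxt⟩
  obtain ⟨T, hT, huT⟩ := h u fun n => (hu n).1
  obtain ⟨t, ht, htT⟩ := Metric.totallyBounded_iff.1 hT (ε / 2) (half_pos hε)
  have hz : ∀ n, ∃ z : t, dist (u n) z < ε / 2 := fun n => by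
    obtain ⟨z, hz, hzn⟩ := Set.mem_iUnion₂.1 (htT (huT n))
    exact ⟨⟨z, hz⟩, hzn⟩
  choose z hz using hz
  have : Finite t := ht
  -- Two terms of an ε-separated sequence fall in the same ball of radius ε/2.
  obtain ⟨m, n, hmn, hzmn⟩ := Finite.exists_ne_map_eq_of_infinite z
  wlog hlt : m < n generalizing m n
  · exact this n m hmn.symm hzmn.symm (hmn.lt_or_gt.resolve_left hlt)
  have h1 := (hu n).2 (u m) ⟨m, hlt, rfl⟩
  have h2 := dist_triangle_right (u n) (u m) (z m : α)
  have h3 := hz n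
  rw [← hzmn] at h3
  linarith [hz m]

section Pushforward

variable {Ω X : Type*} [MeasurableSpace Ω] [MeasurableSpace X] {μ : Measure Ω} {𝕜 : Type*}
  [RCLike 𝕜]

open scoped NNReal

/-- The isometry `e ↦ g • (e ∘ φ)` from `L¹` of the image of `g μ` under `φ` to `L¹(μ)`. -/
theorem exists_clm_coeFn_eq_smul_comp {g : Ω → ℝ≥0} (hg : Measurable g) {φ : Ω → X}
    (hφ : Measurable φ) :
    ∃ J : Lp 𝕜 1 ((μ.withDensity fun x => g x).map φ) →L[𝕜] Lp 𝕜 1 μ,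
      (∀ e, ‖J e‖ = ‖e‖) ∧ ∀ e, J e =ᵐ[μ] fun x => g x • e (φ x) := by
  have hmp : MeasurePreserving φ (μ.withDensity fun x => (g x : ENNReal))
    ((μ.withDensity fun x => g x).map φ) := ⟨hφ, rfl⟩
  have hW : ∀ u : Lp 𝕜 1 (μ.withDensity fun x => (g x : ENNReal)),
      withDensitySMulLI μ hg u =ᵐ[μ] fun x => g x • u x := fun u =>
    (memL1_smul_of_L1_withDensity hg u).coeFn_toLp
  let W : Lp 𝕜 1 (μ.withDensity fun x => (g x : ENNReal)) →ₗᵢ[𝕜] Lp 𝕜 1 μ :=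
    { toFun := withDensitySMulLI μ hg
      map_add' := map_add _
      map_smul' := fun c u => by
        refine Lp.ext ?_
        filter_upwards [hW u, hW (c • u), Lp.coeFn_smul c (withDensitySMulLI μ hg u),
          (ae_withDensity_iff hg.coe_nnreal_ennreal).1 (Lp.coeFn_smul c u)] with x h1 h2 h3 h4
        rw [RingHom.id_apply, h2, h3, Pi.smul_apply, h1]
        rcases eq_or_ne (g x) 0 with h0 | h0
        · simp [h0]
        · rw [h4 (by simpa using h0), Pi.smul_apply, smul_comm]
      norm_map' := (withDensitySMulLI μ hg).norm_map }
  refine ⟨(W.comp (Lp.compMeasurePreservingₗᵢ 𝕜 φ hmp)).toContinuousLinearMap,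
    fun e => (W.comp (Lp.compMeasurePreservingₗᵢ 𝕜 φ hmp)).norm_map e, fun e => ?_⟩
  have h1 := (ae_withDensity_iff hg.coe_nnreal_ennreal).1 (Lp.coeFn_compMeasurePreserving e hmp)
  refine (hW (Lp.compMeasurePreserving φ hmp e)).trans ?_
  filter_upwards [h1] with x hx
  rcases eq_or_ne (g x) 0 with h0 | h0
  · simp [h0]
  · rw [hx (by simpa using h0), Function.comp_apply]

variable {F : Type*} [NormedAddCommGroup F] [NormedSpace 𝕜 F]

/-- A weakly compact operator on `L¹` maps order intervals to totally bounded sets. -/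
theorem totallyBounded_image_of_ae_norm_le (U : Lp 𝕜 1 μ →L[𝕜] F) {C : Set F}
    (hC : IsWeaklyCompact 𝕜 C) (hUC : ∀ f, ‖f‖ ≤ 1 → U f ∈ C) {g : Ω → ℝ≥0} (hg : Measurable g)
    (hgi : ∫⁻ x, g x ∂μ ≠ ⊤) : TotallyBounded (U '' {f | ∀ᵐ x ∂μ, ‖f x‖ ≤ g x}) := by
  refine Metric.totallyBounded_of_forall_seq fun u hu => ?_
  choose f hf hfu using hu
  -- Where g = 0 the inverse is 0, which is harmless since `f n` vanishes a.e. there; thus `J` sends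
  -- the n-th coordinate function to `f n`.
  set φ : Ω → ℕ → 𝕜 := fun x n => (g x)⁻¹ • f n x with hφdef
  have hφ : Measurable φ := measurable_pi_lambda _ fun n =>
    hg.inv.smul (Lp.stronglyMeasurable (f n)).measurable
  have hfin : IsFiniteMeasure (μ.withDensity fun x => (g x : ENNReal)) :=
    isFiniteMeasure_withDensity hgi
  set ν := (μ.withDensity fun x => (g x : ENNReal)).map φ with hν
  obtain ⟨J, hJn, hJ⟩ := exists_clm_coeFn_eq_smul_comp (𝕜 := 𝕜) (μ := μ) hg hφ
  have hle : ∀ n, ∀ᵐ x ∂ν, ‖x n‖ ≤ 1 := fun n => by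
    rw [hν, ae_map_iff hφ.aemeasurable
      (measurableSet_le (measurable_pi_apply n).norm measurable_const),
      ae_withDensity_iff hg.coe_nnreal_ennreal]
    filter_upwards [hf n] with x hx h0
    have h0' : g x ≠ 0 := by simpa using h0
    have hpos : (0 : ℝ) < g x := NNReal.coe_pos.2 (pos_iff_ne_zero.2 h0')
    simp only [hφdef, NNReal.smul_def, norm_smul, NNReal.coe_inv, norm_inv, NNReal.norm_eq]
    rw [inv_mul_le_iff₀ hpos, mul_one]
    exact hx
  have hmem : ∀ n, MemLp (fun x : ℕ → 𝕜 => x n) 1 ν := fun n =>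
    MemLp.of_bound (measurable_pi_apply n).aestronglyMeasurable 1 (hle n)
  have : Fact ((1 : ENNReal) ≠ ⊤) := ⟨ENNReal.one_ne_top⟩
  -- The σ-algebra of `ℕ → 𝕜` is countably generated, so L¹(ν) and hence the range of `U.comp J` are
  -- separable.
  refine ⟨_, totallyBounded_image_of_ae_norm_le_one (U.comp J)
    (TopologicalSpace.isSeparable_range (U.comp J).continuous) hC
    (fun e he => hUC _ ((hJn e).trans_le he)), fun n => ⟨(hmem n).toLp, ?_, ?_⟩⟩
  · filter_upwards [(hmem n).coeFn_toLp, hle n] with x h1 h2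
    rwa [h1]
  · rw [ContinuousLinearMap.comp_apply, ← hfu n]
    congr 1
    refine Lp.ext ?_
    have h1 := (ae_withDensity_iff hg.coe_nnreal_ennreal).1
      (ae_of_ae_map hφ.aemeasurable (hmem n).coeFn_toLp)
    filter_upwards [hJ (hmem n).toLp, h1, hf n] with x h2 h3 h4
    rw [h2]
    rcases eq_or_ne (g x) 0 with h0 | h0
    · rw [h0, NNReal.coe_zero, norm_le_zero_iff] at h4
      rw [h0, h4, zero_smul]
    · rw [h3 (by simpa using h0)]
      simp only [hφdef]
      rw [smul_smul, mul_inv_cancel₀ h0, one_smul]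

end Pushforward

/-! ### Conclusion for weakly compact sets. -/

section DunfordPettis

variable {Ω : Type*} [MeasurableSpace Ω] {μ : Measure Ω} {𝕜 : Type*} [RCLike 𝕜]
  {F : Type*} [NormedAddCommGroup F] [NormedSpace 𝕜 F]

theorem totallyBounded_image_of_isWeaklyCompact (U : Lp 𝕜 1 μ →L[𝕜] F) {C : Set F}
    (hC : IsWeaklyCompact 𝕜 C) (hUC : ∀ f, ‖f‖ ≤ 1 → U f ∈ C) {A : Set (Lp 𝕜 1 μ)}
    (hA : IsWeaklyCompact 𝕜 A) : TotallyBounded (U '' A) := by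
  refine Metric.totallyBounded_of_forall_exists_dist_le fun ε hε => ?_
  set δ : ℝ := ε / (‖U‖ + 1) with hδ
  have hδ0 : 0 < δ := by positivity
  obtain ⟨G, hGm, hGi, hG0, hG⟩ := hA.exists_integrable_setIntegral_norm_le hδ0
  refine ⟨_, totallyBounded_image_of_ae_norm_le U hC hUC (g := fun x => (G x).toNNReal)
    hGm.real_toNNReal hGi.lintegral_lt_top.ne, ?_⟩
  rintro _ ⟨f, hf, rfl⟩
  set D : Set Ω := {x | G x < ‖f x‖} with hD
  have hDm : MeasurableSet D := measurableSet_lt hGm (Lp.stronglyMeasurable f).measurable.norm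
  -- The truncation lies in the order interval of `G`, at L¹ distance ∫_D |f| ≤ δ from `f`.
  have hmem : MemLp (Dᶜ.indicator f) 1 μ := (Lp.memLp f).indicator hDm.compl
  refine ⟨_, ⟨hmem.toLp, ?_, rfl⟩, ?_⟩
  · filter_upwards [hmem.coeFn_toLp] with x hx
    rw [hx, Real.coe_toNNReal _ (hG0 x)]
    by_cases hxD : x ∈ D
    · simpa [hxD] using hG0 x
    · simpa [hxD] using not_lt.1 hxD
  · rw [dist_eq_norm, ← map_sub]
    have h1 : ‖f - hmem.toLp‖ ≤ δ := by
      rw [L1.norm_eq_integral_norm]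
      refine le_trans (le_of_eq ?_) (hG f hf)
      rw [← integral_indicator hDm]
      refine integral_congr_ae ?_
      filter_upwards [Lp.coeFn_sub f hmem.toLp, hmem.coeFn_toLp] with x h2 h3
      rw [h2, Pi.sub_apply, h3]
      by_cases hxD : x ∈ D <;> simp [hxD]
    calc ‖U (f - hmem.toLp)‖ ≤ ‖U‖ * δ := U.le_opNorm_of_le h1
      _ ≤ (‖U‖ + 1) * δ := mul_le_mul_of_nonneg_right (by linarith) hδ0.le
      _ = ε := mul_div_cancel₀ _ (by positivity)

theorem IsWeaklyCompactOperator.isCompact_image_of_isWeaklyCompact [CompleteSpace F]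
    {U : Lp 𝕜 1 μ →L[𝕜] F} (hU : IsWeaklyCompactOperator U) {A : Set (Lp 𝕜 1 μ)}
    (hA : IsWeaklyCompact 𝕜 A) : IsCompact (U '' A) := by
  have hB : IsRelativelyWeaklyCompact 𝕜 (U '' Metric.closedBall 0 1) :=
    hU _ (NormedSpace.isVonNBounded_closedBall 𝕜 _ 1)
  set C : Set F := (toWeakSpace 𝕜 F).symm '' closure (toWeakSpace 𝕜 F '' (U '' Metric.closedBall 0 1))
    with hCdef
  have hC : IsWeaklyCompact 𝕜 C := by
    rw [IsWeaklyCompact, hCdef, Set.image_image]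
    simpa using! hB
  refine (totallyBounded_image_of_isWeaklyCompact U hC (fun f hf => ?_) hA).isCompact_of_isClosed
    (hA.image U).isClosed
  exact ⟨toWeakSpace 𝕜 F (U f),
    subset_closure ⟨_, ⟨f, mem_closedBall_zero_iff.2 hf, rfl⟩, rfl⟩, by simp⟩

end DunfordPettis

theorem corollary66 {Ω : Type*} [MeasurableSpace Ω] (μ : Measure Ω) (𝕜 : Type u𝕜) [RCLike 𝕜] :
    IsDunfordPettisSpace.{_, uF} 𝕜 (Lp 𝕜 1 μ) ∧
      ∀ (F : Type uF) [NormedAddCommGroup F] [NormedSpace 𝕜 F] [CompleteSpace F]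
        (U : Lp 𝕜 1 μ →L[𝕜] F), IsWeaklyCompactOperator U →
          ∀ A : Set (Lp 𝕜 1 μ), IsWeaklyCompact 𝕜 A → IsCompact (U '' A) :=
  ⟨fun _ _ _ _ _ hU _ _ _ hA => (hU.isCompact_image_of_isWeaklyCompact hA).closure,
    fun _ _ _ _ _ hU _ hA => hU.isCompact_image_of_isWeaklyCompact hA⟩
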